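/- For real numbers $\tilde p,\tilde q$ (written $p,q$ in this display) let $$\begin{aligned} Q_{\tilde p\tilde q}(t)={}&t^{10}+(3q^4-10q^3p-13q^2p^2-8p^3q-2p^4)\,t^8\\ &+(p^8-40q^7p-136q^4p^4+2q^8+14p^6q^2-148q^6p^2-208q^5p^3+8p^7q-28p^5q^3)\,t^6\\ &-(10p^9q^3+302q^{10}p^2+836q^7p^5+60q^{11}p+200p^7q^5+704q^9p^3+p^{10}q^2+494q^6p^6+2q^{12}+956q^8p^4+55p^8q^4)\,t^4\\ &-(6p^{10}q^6+1444q^{11}p^5+1230q^{10}p^6+712q^9p^7+40q^{15}p+1160q^{12}p^4+624q^{13}p^3+269q^8p^8+3q^{16}+60p^9q^7+212q^{14}p^2)\,t^2\\ &-q^{10}(p+q)^{10}, \end{aligned}$$ considered as a polynomial in the complex variable $t$. The equation $u^4+8u^2-12iu-4=0$ has exactly four distinct complex roots $u_2,u_3,u_4,u_5$. Let $\tilde q\ge 97|\tilde p|$. (a) If $\tilde p\neq 0$, then for each $k=2,\dots,5$ the polynomial $Q_{\tilde p\tilde q}$ has exactly one root, counted with multiplicity, in the open disk $$\Bigl|t-i\tilde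 q^2-u_k\tilde p\tilde q+\frac{u_k+iu_k^2}{2}\tilde p^2\Bigr|<\frac{51|\tilde p|^3}{\tilde q}.$$ (b) If $\tilde p=0$, then the four closed disks with these centres and radii (the radius being read as $0$ if also $\tilde q=0$) collapse to the single point $t=i\tilde q^2$, which is a multiple root of $Q_{\tilde p\tilde q}$; if moreover $\tilde q>0$, its multiplicity is exactly $4$. -/

import Mathlib

open Polynomial

/-- The cuboid characteristic polynomial `Q_{p̃q̃}(t)`, of degree ten in `t`, in the shifted
parameters `p̃ = p - q`, `q̃ = q`, as a complex polynomial in `t`. -/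
noncomputable def cuboidPoly (p q : ℂ) : ℂ[X] :=
  X ^ 10
  + C (3 * q ^ 4 - 10 * q ^ 3 * p - 13 * q ^ 2 * p ^ 2 - 8 * p ^ 3 * q - 2 * p ^ 4) * X ^ 8
  + C (p ^ 8 - 40 * q ^ 7 * p - 136 * q ^ 4 * p ^ 4 + 2 * q ^ 8 + 14 * p ^ 6 * q ^ 2
      - 148 * q ^ 6 * p ^ 2 - 208 * q ^ 5 * p ^ 3 + 8 * p ^ 7 * q - 28 * p ^ 5 * q ^ 3) * X ^ 6
  - C (10 * p ^ 9 * q ^ 3 + 302 * q ^ 10 * p ^ 2 + 836 * q ^ 7 * p ^ 5 + 60 * q ^ 11 * p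
      + 200 * p ^ 7 * q ^ 5 + 704 * q ^ 9 * p ^ 3 + p ^ 10 * q ^ 2 + 494 * q ^ 6 * p ^ 6
      + 2 * q ^ 12 + 956 * q ^ 8 * p ^ 4 + 55 * p ^ 8 * q ^ 4) * X ^ 4
  - C (6 * p ^ 10 * q ^ 6 + 1444 * q ^ 11 * p ^ 5 + 1230 * q ^ 10 * p ^ 6 + 712 * q ^ 9 * p ^ 7
      + 40 * q ^ 15 * p + 1160 * q ^ 12 * p ^ 4 + 624 * q ^ 13 * p ^ 3 + 269 * q ^ 8 * p ^ 8
      + 3 * q ^ 16 + 60 * p ^ 9 * q ^ 7 + 212 * q ^ 14 * p ^ 2) * X ^ 2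
  + C (-210 * q ^ 16 * p ^ 4 - q ^ 10 * p ^ 10 - q ^ 20 - 210 * q ^ 14 * p ^ 6
      - 120 * q ^ 13 * p ^ 7 - 45 * q ^ 12 * p ^ 8 - 10 * q ^ 11 * p ^ 9 - 10 * q ^ 19 * p
      - 120 * q ^ 17 * p ^ 3 - 252 * q ^ 15 * p ^ 5 - 45 * q ^ 18 * p ^ 2)

/-- The set of complex roots of `u⁴ + 8u² - 12iu - 4`. -/
def quarticRoots : Set ℂ :=
  {u | u ^ 4 + 8 * u ^ 2 - 12 * Complex.I * u - 4 = 0}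

/-- The centre `i q̃² + u p̃ q̃ - (u + i u²)/2 · p̃²` of the disk attached to `u`. -/
noncomputable def diskCenter (u : ℂ) (p q : ℝ) : ℂ :=
  Complex.I * (q : ℂ) ^ 2 + u * (p : ℂ) * (q : ℂ)
    - (u + Complex.I * u ^ 2) / 2 * (p : ℂ) ^ 2

/-- The common radius `51 |p̃|³ / q̃` of the disks. -/
noncomputable def diskRadius (p q : ℝ) : ℝ := 51 * |p| ^ 3 / q

/-!
Put `e = p / q`, `t = i q² (1 + e ξ)` and `u = i y`. Since `Q` is even in `t`, the polynomial
`Q(t)` equals `- q ^ 20 * e ^ 4 * S(e, ξ)` with an integer polynomial `S`, and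
`S(0, y) = 32 (y⁴ - 8 y² + 12 y - 4)` is the quartic of the statement in the variable `y`. Its
four roots are simple, so each continues to one analytic branch of zeros of `S(e, ·)`. The centre
`c = y + e v`, `v = (y² - y) / 2`, is the first-order expansion of that branch, and the disk of
the statement is `|ξ - c| < 51 e²`.

On this disk the derivative of `S` in `ξ` stays close to the nonzero constant
`δ = 128 y³ - 512 y + 384`, while `S(e, c) = O(e²)`; hence `ξ ↦ ξ - S(e, ξ) / δ` is a contraction of
the closed disk into its interior, and there is one zero, which is simple
(`exists_unique_zero_of_norm_sub_le`). What remains is to make this quantitative for `|e| ≤ 1 / 97`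
(`exists_unique_zero_scaledTerms`). The two leading nonvanishing orders in `e` of `S(e, c)` and the
orders `1` and `2` of the derivative are reduced modulo the quartic to cubics in `y`
(`eval_low_shift`, `eval_low_shift_deriv`) and bounded through enclosures of the roots
(`root_location`). Higher orders are bounded monomial by monomial: sparse polynomials are lists of
integer data, so that their binomial expansions and majorants are computed by the kernel
(`Terms.norm_eval_le`).

For `p = 0` the polynomial factors as `(t² + q⁴)⁴ (t² - q⁴)`.
-/

/-! ### Sparse polynomials in three variables -/

/-- A sparse integer polynomial in `e, y, v`: the entry `(c, i, j, m)` stands for the monomial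
`c * e ^ i * y ^ j * v ^ m`. Repeated exponents and zero coefficients are allowed. -/
abbrev Terms := List (ℤ × ℕ × ℕ × ℕ)

namespace Terms

/-- The value of a sparse polynomial at a complex point. -/
def eval (L : Terms) (e y v : ℂ) : ℂ :=
  (L.map fun t => (t.1 : ℂ) * e ^ t.2.1 * y ^ t.2.2.1 * v ^ t.2.2.2).sum

/-- The value at `(E, M, V)` of the polynomial whose coefficients are the absolute values of those
of `L`. It is rational so that the kernel can evaluate it. -/
def majorant (L : Terms) (E M V : ℚ) : ℚ :=
  (L.map fun t => |(t.1 : ℚ)| * E ^ t.2.1 * M ^ t.2.2.1 * V ^ t.2.2.2).sum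

/-- The partial derivative with respect to the second variable `y`. -/
def deriv (L : Terms) : Terms :=
  L.map fun t => (t.1 * t.2.2.1, t.2.1, t.2.2.1 - 1, t.2.2.2)

/-- The substitution `y ↦ y + e * v`, expanded by the binomial theorem. -/
def shift (L : Terms) : Terms :=
  L.flatMap fun t => (List.range (t.2.2.1 + 1)).map fun l =>
    (t.1 * (t.2.2.1.choose l : ℤ), t.2.1 + l, t.2.2.1 - l, t.2.2.2 + l)

/-- The monomials of degree less than `r` in `e`. -/
def low (r : ℕ) (L : Terms) : Terms := L.filter fun t => t.2.1 < r

/-- The monomials of degree at least `r` in `e`. -/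
def high (r : ℕ) (L : Terms) : Terms := L.filter fun t => ¬ t.2.1 < r

theorem eval_cons (t : ℤ × ℕ × ℕ × ℕ) (L : Terms) (e y v : ℂ) :
    eval (t :: L) e y v = (t.1 : ℂ) * e ^ t.2.1 * y ^ t.2.2.1 * v ^ t.2.2.2 + eval L e y v := by
  simp [eval]

theorem eval_append (L L' : Terms) (e y v : ℂ) :
    eval (L ++ L') e y v = eval L e y v + eval L' e y v := by
  simp [eval]

theorem hasDerivAt_eval (L : Terms) (e y v : ℂ) :
    HasDerivAt (fun ξ => L.eval e ξ v) (L.deriv.eval e y v) y := by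
  induction L with
  | nil => simpa [eval, deriv] using hasDerivAt_const y (0 : ℂ)
  | cons t L ih =>
    have h := ((hasDerivAt_pow t.2.2.1 y).const_mul ((t.1 : ℂ) * e ^ t.2.1)).mul_const
      (v ^ t.2.2.2)
    have h' := h.add ih
    simp only [deriv, List.map_cons] at h' ⊢
    simp only [eval_cons]
    refine h'.congr_deriv ?_
    push_cast
    ring

theorem eval_shift (L : Terms) (e y v : ℂ) :
    L.shift.eval e y v = L.eval e (y + e * v) v := by
  induction L with
  | nil => simp [eval, shift]
  | cons t L ih =>
    have hs : shift (t :: L) = ((List.range (t.2.2.1 + 1)).map fun l =>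
        (t.1 * (t.2.2.1.choose l : ℤ), t.2.1 + l, t.2.2.1 - l, t.2.2.2 + l)) ++ shift L := by
      simp [shift]
    rw [hs, eval_append, ih, eval_cons, add_comm y, add_pow, Finset.mul_sum, Finset.sum_mul]
    congr 1
    simp only [eval, List.map_map, ← List.sum_toFinset _ (List.nodup_range),
      List.toFinset_range]
    refine Finset.sum_congr rfl fun l _ => ?_
    simp only [Function.comp]
    push_cast
    ring

theorem eval_low_add_eval_high (r : ℕ) (L : Terms) (e y v : ℂ) :
    (L.low r).eval e y v + (L.high r).eval e y v = L.eval e y v := by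
  induction L with
  | nil => simp [eval, low, high]
  | cons t L ih =>
    simp only [low, high, List.filter_cons] at ih ⊢
    by_cases h : t.2.1 < r <;> simp [h, eval_cons, ← ih] <;> ring

/-- If every monomial of `L` has degree at least `r` in `e`, then shrinking `|e|` below `E` gains
the factor `(|e| / E) ^ r` over the majorant. -/
theorem norm_eval_le {L : Terms} {r : ℕ} (hr : ∀ t ∈ L, r ≤ t.2.1) {E M V : ℚ} {e y v : ℂ}
    (hE0 : 0 < E) (he : ‖e‖ ≤ E) (hy : ‖y‖ ≤ M) (hv : ‖v‖ ≤ V) :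
    ‖L.eval e y v‖ ≤ (‖e‖ / E) ^ r * (L.majorant E M V : ℚ) := by
  have hE : (0 : ℝ) < E := by exact_mod_cast hE0
  induction L with
  | nil => simp [eval, majorant]
  | cons t L ih =>
    have ih' := ih fun s hs => hr s (List.mem_cons_of_mem _ hs)
    have hm : ((majorant (t :: L) E M V : ℚ) : ℝ) =
        |(t.1 : ℝ)| * E ^ t.2.1 * M ^ t.2.2.1 * V ^ t.2.2.2 + (majorant L E M V : ℚ) := by
      simp [majorant]
    have hpow : ‖e‖ ^ t.2.1 ≤ (‖e‖ / E) ^ r * (E : ℝ) ^ t.2.1 := by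
      have hq : ‖e‖ / E ≤ 1 := (div_le_one hE).2 he
      have : (‖e‖ / E) ^ t.2.1 ≤ (‖e‖ / E) ^ r :=
        pow_le_pow_of_le_one (by positivity) hq (hr t List.mem_cons_self)
      calc ‖e‖ ^ t.2.1 = (‖e‖ / E) ^ t.2.1 * (E : ℝ) ^ t.2.1 := by
            rw [← mul_pow, div_mul_cancel₀ _ hE.ne']
        _ ≤ _ := by gcongr
    rw [eval_cons, hm, mul_add]
    refine (norm_add_le _ _).trans (add_le_add ?_ ih')
    rw [norm_mul, norm_mul, norm_mul, norm_pow, norm_pow, norm_pow, Complex.norm_intCast]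
    have hM : (0 : ℝ) ≤ M := (norm_nonneg y).trans hy
    calc |(t.1 : ℝ)| * ‖e‖ ^ t.2.1 * ‖y‖ ^ t.2.2.1 * ‖v‖ ^ t.2.2.2
        ≤ |(t.1 : ℝ)| * ((‖e‖ / E) ^ r * (E : ℝ) ^ t.2.1) * (M : ℝ) ^ t.2.2.1
            * (V : ℝ) ^ t.2.2.2 := by gcongr
      _ = _ := by ring

theorem le_of_mem_high {r : ℕ} {L : Terms} : ∀ t ∈ L.high r, r ≤ t.2.1 := by
  intro t ht
  simpa [high] using (List.mem_filter.1 ht).2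

end Terms

/-! ### The rescaled polynomial near `t = i q²` -/

/-- The polynomial `S(e, ξ)`, of degree ten in each variable, with
`Q_{pq}(i q² (1 + e ξ)) = - q ^ 20 * e ^ 4 * S(e, ξ)` for `e = p / q`; see
`eval_cuboidPoly`. The variable `v` does not occur. -/
def scaledTerms : Terms := [
  (32, 0, 4, 0), (-256, 0, 2, 0), (384, 0, 1, 0), (-128, 0, 0, 0), (96, 1, 5, 0), (160, 1, 4, 0),
  (-1024, 1, 3, 0), (704, 1, 2, 0), (704, 1, 1, 0), (-384, 1, 0, 0), (128, 2, 6, 0),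
  (320, 2, 5, 0), (-1008, 2, 4, 0), (-896, 2, 3, 0), (2592, 2, 2, 0), (288, 2, 1, 0),
  (-512, 2, 0, 0), (96, 3, 7, 0), (240, 3, 6, 0), (-160, 3, 5, 0), (-1856, 3, 4, 0),
  (1216, 3, 3, 0), (3152, 3, 2, 0), (-400, 3, 1, 0), (-384, 3, 0, 0), (42, 4, 8, 0),
  (80, 4, 7, 0), (216, 4, 6, 0), (-800, 4, 5, 0), (-944, 4, 4, 0), (2784, 4, 3, 0),
  (1944, 4, 2, 0), (-576, 4, 1, 0), (-168, 4, 0, 0), (10, 5, 9, 0), (10, 5, 8, 0),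
  (104, 5, 7, 0), (16, 5, 6, 0), (-704, 5, 5, 0), (416, 5, 4, 0), (2256, 5, 3, 0),
  (608, 5, 2, 0), (-312, 5, 1, 0), (-40, 5, 0, 0), (1, 6, 10, 0), (13, 6, 8, 0), (64, 6, 7, 0),
  (-80, 6, 6, 0), (-168, 6, 5, 0), (704, 6, 4, 0), (960, 6, 3, 0), (76, 6, 2, 0), (-80, 6, 1, 0),
  (-4, 6, 0, 0), (8, 7, 8, 0), (16, 7, 7, 0), (-28, 7, 6, 0), (84, 7, 5, 0), (320, 7, 4, 0),
  (240, 7, 3, 0), (-8, 7, 1, 0), (2, 8, 8, 0), (14, 8, 6, 0), (48, 8, 5, 0), (70, 8, 4, 0),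
  (40, 8, 3, 0), (8, 9, 6, 0), (6, 9, 5, 0), (10, 9, 4, 0), (4, 9, 3, 0), (1, 10, 6, 0),
  (1, 10, 4, 0)]

theorem eval_cuboidPoly (q e ξ v : ℂ) :
    (cuboidPoly (e * q) q).eval (Complex.I * q ^ 2 * (1 + e * ξ)) =
      -(q ^ 20 * e ^ 4) * scaledTerms.eval e ξ v := by
  have hI : ∀ X : ℂ, (Complex.I * X) ^ 2 = -X ^ 2 := fun X => by
    rw [mul_pow, Complex.I_sq]; ring
  have h4 : ∀ X : ℂ, X ^ 4 = (X ^ 2) ^ 2 := fun X => by ring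
  have h6 : ∀ X : ℂ, X ^ 6 = (X ^ 2) ^ 3 := fun X => by ring
  have h8 : ∀ X : ℂ, X ^ 8 = (X ^ 2) ^ 4 := fun X => by ring
  have h10 : ∀ X : ℂ, X ^ 10 = (X ^ 2) ^ 5 := fun X => by ring
  simp only [cuboidPoly, eval_add, eval_sub, eval_mul, eval_C, eval_pow, eval_X]
  rw [mul_assoc, h4 (Complex.I * _), h6 (Complex.I * _), h8 (Complex.I * _),
    h10 (Complex.I * _), hI]
  simp only [scaledTerms, Terms.eval, List.map_cons, List.map_nil, List.sum_cons, List.sum_nil]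
  push_cast
  ring

theorem low_shift_scaledTerms : (scaledTerms.shift.low 4) = [
  (32, 0, 4, 0), (128, 1, 3, 1), (192, 2, 2, 2), (128, 3, 1, 3), (-256, 0, 2, 0),
  (-512, 1, 1, 1), (-256, 2, 0, 2), (384, 0, 1, 0), (384, 1, 0, 1), (-128, 0, 0, 0),
  (96, 1, 5, 0), (480, 2, 4, 1), (960, 3, 3, 2), (160, 1, 4, 0), (640, 2, 3, 1), (960, 3, 2, 2),
  (-1024, 1, 3, 0), (-3072, 2, 2, 1), (-3072, 3, 1, 2), (704, 1, 2, 0), (1408, 2, 1, 1),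
  (704, 3, 0, 2), (704, 1, 1, 0), (704, 2, 0, 1), (-384, 1, 0, 0), (128, 2, 6, 0),
  (768, 3, 5, 1), (320, 2, 5, 0), (1600, 3, 4, 1), (-1008, 2, 4, 0), (-4032, 3, 3, 1),
  (-896, 2, 3, 0), (-2688, 3, 2, 1), (2592, 2, 2, 0), (5184, 3, 1, 1), (288, 2, 1, 0),
  (288, 3, 0, 1), (-512, 2, 0, 0), (96, 3, 7, 0), (240, 3, 6, 0), (-160, 3, 5, 0),
  (-1856, 3, 4, 0), (1216, 3, 3, 0), (3152, 3, 2, 0), (-400, 3, 1, 0), (-384, 3, 0, 0)] := by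
  decide +kernel

theorem low_shift_deriv_scaledTerms : (scaledTerms.deriv.shift.low 3) = [
  (128, 0, 3, 0), (384, 1, 2, 1), (384, 2, 1, 2), (-512, 0, 1, 0), (-512, 1, 0, 1),
  (384, 0, 0, 0), (0, 0, 0, 0), (480, 1, 4, 0), (1920, 2, 3, 1), (640, 1, 3, 0), (1920, 2, 2, 1),
  (-3072, 1, 2, 0), (-6144, 2, 1, 1), (1408, 1, 1, 0), (1408, 2, 0, 1), (704, 1, 0, 0),
  (0, 1, 0, 0), (768, 2, 5, 0), (1600, 2, 4, 0), (-4032, 2, 3, 0), (-2688, 2, 2, 0),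
  (5184, 2, 1, 0), (288, 2, 0, 0), (0, 2, 0, 0)] := by
  decide +kernel

/-- The centre `y + e v` with `v = (y² - y) / 2` is chosen so that the first two orders in `e` of
`S` vanish at a root `y` of the quartic. -/
theorem eval_low_shift {e y v : ℂ} (hy : y ^ 4 - 8 * y ^ 2 + 12 * y - 4 = 0)
    (hv : v = (y ^ 2 - y) / 2) :
    (scaledTerms.shift.low 4).eval e y v =
      e ^ 2 * ((-1088 * y ^ 3 + 3776 * y ^ 2 - 4224 * y + 1280)
        + e * (18176 * y ^ 3 - 62160 * y ^ 2 + 68896 * y - 20928)) := by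
  rw [low_shift_scaledTerms]
  simp only [Terms.eval, List.map_cons, List.map_nil, List.sum_cons, List.sum_nil]
  push_cast
  subst hv
  linear_combination (32 + e * (160 * y + 96) + e ^ 2 * (416 * y ^ 2 + 304 * y + 448)
    + e ^ 3 * (736 * y ^ 3 + 368 * y ^ 2 + 1952 * y - 5136)) * hy

theorem eval_low_shift_deriv {e y v : ℂ} (hy : y ^ 4 - 8 * y ^ 2 + 12 * y - 4 = 0)
    (hv : v = (y ^ 2 - y) / 2) :
    (scaledTerms.deriv.shift.low 3).eval e y v =
      (128 * y ^ 3 - 512 * y + 384) + e * (448 * y ^ 3 + 2048 * y ^ 2 - 6400 * y + 3392)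
        + e ^ 2 * (6624 * y ^ 3 - 9536 * y ^ 2 - 5120 * y + 5920) := by
  rw [low_shift_deriv_scaledTerms]
  simp only [Terms.eval, List.map_cons, List.map_nil, List.sum_cons, List.sum_nil]
  push_cast
  subst hv
  linear_combination (1824 * e ^ 2 * y + 1408 * e ^ 2 + 672 * e) * hy

/-! ### A quantitative inverse function criterion -/

/-- If `S'` is within `k` of a constant `d` on the closed ball of radius `r` about `c` and
`‖S c‖ + k r < ‖d‖ r`, then `S` has exactly one zero in the open ball, and it is simple. The map
`ξ ↦ ξ - S ξ / d` is a contraction of the closed ball into the open one. -/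
theorem exists_unique_zero_of_norm_sub_le {S S' : ℂ → ℂ} {c d : ℂ} {r k : ℝ} (hr : 0 < r)
    (hS : ∀ ξ, HasDerivAt S (S' ξ) ξ) (hk : ∀ ξ ∈ Metric.closedBall c r, ‖S' ξ - d‖ ≤ k)
    (hc : ‖S c‖ + k * r < ‖d‖ * r) :
    ∃ t ∈ Metric.ball c r, S t = 0 ∧ S' t ≠ 0 ∧ ∀ s ∈ Metric.ball c r, S s = 0 → s = t := by
  have hcmem : c ∈ Metric.closedBall c r := Metric.mem_closedBall_self hr.le
  have hk0 : 0 ≤ k := (norm_nonneg _).trans (hk c hcmem)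
  have hkd : k < ‖d‖ := by
    by_contra! h
    nlinarith [norm_nonneg (S c), mul_le_mul_of_nonneg_right h hr.le]
  have hd : 0 < ‖d‖ := hk0.trans_lt hkd
  have hd0 : d ≠ 0 := norm_pos_iff.1 hd
  set g : ℂ → ℂ := fun ξ => ξ - S ξ / d with hg
  have hg' : ∀ ξ, HasDerivAt g (1 - S' ξ / d) ξ := fun ξ =>
    (hasDerivAt_id ξ).sub ((hS ξ).div_const d)
  have hbound : ∀ ξ ∈ Metric.closedBall c r, ‖1 - S' ξ / d‖ ≤ k / ‖d‖ := by
    intro ξ hξ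
    have : 1 - S' ξ / d = -(S' ξ - d) / d := by field_simp; ring
    rw [this, norm_div, norm_neg]
    gcongr
    exact hk ξ hξ
  have hlip : ∀ x ∈ Metric.closedBall c r, ∀ y ∈ Metric.closedBall c r,
      ‖g y - g x‖ ≤ k / ‖d‖ * ‖y - x‖ := fun x hx y hy =>
    (convex_closedBall c r).norm_image_sub_le_of_norm_hasDerivWithin_le
      (fun z _ => (hg' z).hasDerivWithinAt) hbound hx hy
  have hk1 : k / ‖d‖ < 1 := (div_lt_one hd).2 hkd
  have hinto : ∀ x ∈ Metric.closedBall c r, g x ∈ Metric.ball c r := by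
    intro x hx
    have hx' : ‖x - c‖ ≤ r := mem_closedBall_iff_norm.1 hx
    have h1 : ‖g x - g c‖ ≤ k / ‖d‖ * r :=
      (hlip c hcmem x hx).trans (mul_le_mul_of_nonneg_left hx' (by positivity))
    have h2 : ‖g c - c‖ = ‖S c‖ / ‖d‖ := by simp [hg]
    rw [mem_ball_iff_norm]
    calc ‖g x - c‖ = ‖(g x - g c) + (g c - c)‖ := by ring_nf
      _ ≤ k / ‖d‖ * r + ‖S c‖ / ‖d‖ := (norm_add_le _ _).trans (add_le_add h1 h2.le)
      _ = (‖S c‖ + k * r) / ‖d‖ := by ring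
      _ < r := by rw [div_lt_iff₀ hd]; linarith
  have hmaps : Set.MapsTo g (Metric.closedBall c r) (Metric.closedBall c r) := fun x hx =>
    Metric.ball_subset_closedBall (hinto x hx)
  have hcontr : ContractingWith ⟨k / ‖d‖, by positivity⟩ (hmaps.restrict g _ _) := by
    refine ⟨by exact_mod_cast hk1, LipschitzWith.of_dist_le_mul fun x y => ?_⟩
    have := hlip y y.2 x x.2
    rw [Subtype.dist_eq, Subtype.dist_eq, dist_eq_norm, dist_eq_norm]
    exact this
  obtain ⟨t, ht, hfix, -⟩ := hcontr.exists_fixedPoint' Metric.isClosed_closedBall.isComplete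
    hmaps hcmem (edist_ne_top _ _)
  have hSt : S t = 0 := by
    have : t - S t / d = t := hfix
    have : S t / d = 0 := by linear_combination -this
    simpa [hd0] using this
  refine ⟨t, hfix ▸ hinto t ht, hSt, fun h0 => ?_, fun s hs hSs => ?_⟩
  · have := hk t ht
    rw [h0, zero_sub, norm_neg] at this
    linarith
  · have h := hlip t ht s (Metric.ball_subset_closedBall hs)
    simp only [hg, hSs, hSt, zero_div, sub_zero] at h
    by_contra hne
    have : 0 < ‖s - t‖ := norm_pos_iff.2 (sub_ne_zero.2 hne)
    nlinarith

/-! ### Zeros of the rescaled polynomial near a root of the quartic -/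

/-- The numerical criterion at one root `y` of the quartic. The bounds `a₀`, `a₁` control the two
leading orders in `e` of `S` at the centre of the disk, `b₁`, `b₂` those of `∂S/∂ξ - δ`, where
`δ = 128 y³ - 512 y + 384`; all higher orders are estimated by majorants. -/
theorem exists_unique_zero_scaledTerms {y v : ℂ} (hy : y ^ 4 - 8 * y ^ 2 + 12 * y - 4 = 0)
    (hv : v = (y ^ 2 - y) / 2) {M V a₀ a₁ b₁ b₂ δ : ℚ} (hM : ‖y‖ ≤ M) (hV : ‖v‖ ≤ V)
    (ha₀ : ‖-1088 * y ^ 3 + 3776 * y ^ 2 - 4224 * y + 1280‖ ≤ a₀)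
    (ha₁ : ‖18176 * y ^ 3 - 62160 * y ^ 2 + 68896 * y - 20928‖ ≤ a₁)
    (hb₁ : ‖448 * y ^ 3 + 2048 * y ^ 2 - 6400 * y + 3392‖ ≤ b₁)
    (hb₂ : ‖6624 * y ^ 3 - 9536 * y ^ 2 - 5120 * y + 5920‖ ≤ b₂)
    (hδ : δ ≤ ‖128 * y ^ 3 - 512 * y + 384‖)
    (hnum : a₀ + a₁ / 97 + 97 ^ 2 * (scaledTerms.shift.high 4).majorant (1 / 97) M V
      + 51 * (b₁ / 97 + b₂ / 97 ^ 2 + (scaledTerms.deriv.shift.high 3).majorant (1 / 97) M V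
        + 51 / 97 ^ 2 * scaledTerms.deriv.deriv.majorant (1 / 97) (M + V / 97 + 51 / 97 ^ 2) V)
        < 51 * δ)
    {e : ℝ} (he0 : e ≠ 0) (he : |e| ≤ 1 / 97) :
    ∃ t ∈ Metric.ball (y + e * v) (51 * e ^ 2), scaledTerms.eval e t v = 0 ∧
      scaledTerms.deriv.eval e t v ≠ 0 ∧
      ∀ s ∈ Metric.ball (y + e * v) (51 * e ^ 2), scaledTerms.eval e s v = 0 → s = t := by
  set T₀ := (scaledTerms.shift.high 4).majorant (1 / 97) M V with hT₀
  set T₁ := (scaledTerms.deriv.shift.high 3).majorant (1 / 97) M V with hT₁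
  set T₂ := scaledTerms.deriv.deriv.majorant (1 / 97) (M + V / 97 + 51 / 97 ^ 2) V with hT₂
  have hnum' : (a₀ + a₁ / 97 + 97 ^ 2 * T₀ + 51 * (b₁ / 97 + b₂ / 97 ^ 2 + T₁
      + 51 / 97 ^ 2 * T₂) : ℝ) < 51 * δ := by
    have h := (Rat.cast_lt (K := ℝ)).2 hnum
    push_cast at h
    linarith
  have hen : ‖(e : ℂ)‖ = |e| := by simp
  have hen' : ‖(e : ℂ)‖ ≤ ((1 / 97 : ℚ) : ℝ) := by rw [hen]; push_cast; exact he
  have hE : (0 : ℚ) < 1 / 97 := by norm_num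
  have hepos : 0 < |e| := abs_pos.2 he0
  have hesq : 0 < e ^ 2 := by positivity
  have hesq' : e ^ 2 ≤ 1 / 97 ^ 2 := by
    rw [← sq_abs]
    calc |e| ^ 2 ≤ (1 / 97) ^ 2 := by gcongr
      _ = _ := by norm_num
  have ha₁0 := (norm_nonneg _).trans ha₁
  have hb₁0 := (norm_nonneg _).trans hb₁
  have hb₂0 := (norm_nonneg _).trans hb₂
  -- the tail of `S` at the centre is `O(e ^ 4)`, two orders more than the radius
  have htail₀ : ‖(scaledTerms.shift.high 4).eval e y v‖ ≤ e ^ 2 * (97 ^ 2 * T₀) := by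
    have h := Terms.norm_eval_le (L := scaledTerms.shift.high 4) Terms.le_of_mem_high hE hen'
      hM hV
    have hT0 : (0 : ℝ) ≤ T₀ := by
      have : ∀ L : Terms, (0 : ℚ) ≤ L.majorant (1 / 97) M V := by
        intro L
        have hM0 : (0 : ℚ) ≤ M := by exact_mod_cast (norm_nonneg _).trans hM
        have hV0 : (0 : ℚ) ≤ V := by exact_mod_cast (norm_nonneg _).trans hV
        refine List.sum_nonneg fun x hx => ?_
        obtain ⟨t, -, rfl⟩ := List.mem_map.1 hx
        positivity
      exact_mod_cast this _
    refine h.trans ?_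
    rw [← hT₀, hen, ← mul_assoc]
    refine mul_le_mul_of_nonneg_right ?_ hT0
    push_cast
    have : (|e| / (1 / 97)) ^ 4 = e ^ 2 * (97 ^ 4 * e ^ 2) := by
      rw [← sq_abs e]; ring
    rw [this]
    refine mul_le_mul_of_nonneg_left ?_ hesq.le
    linarith
  have hcentre : ‖scaledTerms.eval e (y + e * v) v‖ ≤
      e ^ 2 * (a₀ + a₁ / 97 + 97 ^ 2 * T₀) := by
    rw [← Terms.eval_shift, ← Terms.eval_low_add_eval_high 4, eval_low_shift hy hv]
    refine (norm_add_le _ _).trans ?_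
    rw [mul_add (e ^ 2)]
    refine add_le_add ?_ htail₀
    rw [norm_mul, norm_pow, hen, sq_abs]
    refine mul_le_mul_of_nonneg_left ((norm_add_le _ _).trans (add_le_add ha₀ ?_)) hesq.le
    rw [norm_mul, hen, div_eq_mul_one_div, mul_comm]
    exact mul_le_mul ha₁ he hepos.le ha₁0
  have hderiv : ∀ ξ ∈ Metric.closedBall (y + e * v) (51 * e ^ 2),
      ‖scaledTerms.deriv.eval e ξ v - (128 * y ^ 3 - 512 * y + 384)‖ ≤
        b₁ / 97 + b₂ / 97 ^ 2 + T₁ + 51 / 97 ^ 2 * T₂ := by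
    intro ξ hξ
    have hball : ∀ ζ ∈ Metric.closedBall (y + e * v) (51 * e ^ 2),
        ‖scaledTerms.deriv.deriv.eval e ζ v‖ ≤ T₂ := by
      intro ζ hζ
      have hζn : ‖ζ‖ ≤ ((M + V / 97 + 51 / 97 ^ 2 : ℚ) : ℝ) := by
        have h1 : ‖ζ - (y + e * v)‖ ≤ 51 * e ^ 2 := mem_closedBall_iff_norm.1 hζ
        have h2 : ‖(e : ℂ) * v‖ ≤ V / 97 := by
          rw [norm_mul, hen, div_eq_mul_one_div, mul_comm]
          exact mul_le_mul hV he hepos.le ((norm_nonneg _).trans hV)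
        calc ‖ζ‖ = ‖y + e * v + (ζ - (y + e * v))‖ := by ring_nf
          _ ≤ ‖y‖ + ‖(e : ℂ) * v‖ + ‖ζ - (y + e * v)‖ := norm_add₃_le
          _ ≤ M + V / 97 + 51 / 97 ^ 2 := by linarith
          _ = _ := by push_cast; ring
      have h := Terms.norm_eval_le (L := scaledTerms.deriv.deriv) (r := 0)
        (fun _ _ => Nat.zero_le _) hE hen' hζn hV
      simpa only [pow_zero, one_mul] using h
    have hcmem : y + e * v ∈ Metric.closedBall (y + e * v) (51 * e ^ 2) :=
      Metric.mem_closedBall_self (by positivity)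
    have hT20 : (0 : ℝ) ≤ T₂ := (norm_nonneg _).trans (hball _ hcmem)
    have h1 : ‖scaledTerms.deriv.eval e ξ v - scaledTerms.deriv.eval e (y + e * v) v‖ ≤
        51 / 97 ^ 2 * T₂ := by
      refine ((convex_closedBall _ _).norm_image_sub_le_of_norm_hasDerivWithin_le
        (fun z _ => (Terms.hasDerivAt_eval _ _ z v).hasDerivWithinAt) hball hcmem hξ).trans ?_
      have h2 : ‖ξ - (y + e * v)‖ ≤ 51 * e ^ 2 := mem_closedBall_iff_norm.1 hξ
      rw [mul_comm]
      exact mul_le_mul_of_nonneg_right (by linarith) hT20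
    have htail₁ : ‖(scaledTerms.deriv.shift.high 3).eval e y v‖ ≤ T₁ := by
      have h := Terms.norm_eval_le (L := scaledTerms.deriv.shift.high 3) (r := 0)
        (fun _ _ => Nat.zero_le _) hE hen' hM hV
      simpa only [pow_zero, one_mul] using h
    have h2 : ‖scaledTerms.deriv.eval e (y + e * v) v - (128 * y ^ 3 - 512 * y + 384)‖ ≤
        b₁ / 97 + b₂ / 97 ^ 2 + T₁ := by
      rw [← Terms.eval_shift, ← Terms.eval_low_add_eval_high 3, eval_low_shift_deriv hy hv]
      have h3 : ‖(e : ℂ) * (448 * y ^ 3 + 2048 * y ^ 2 - 6400 * y + 3392)‖ ≤ b₁ / 97 := by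
        rw [norm_mul, hen, div_eq_mul_one_div, mul_comm]
        exact mul_le_mul hb₁ he hepos.le hb₁0
      have h4 : ‖(e : ℂ) ^ 2 * (6624 * y ^ 3 - 9536 * y ^ 2 - 5120 * y + 5920)‖ ≤
          b₂ / 97 ^ 2 := by
        rw [norm_mul, norm_pow, hen, sq_abs, div_eq_mul_one_div, mul_comm]
        exact mul_le_mul hb₂ hesq' hesq.le hb₂0
      calc _ = ‖(e : ℂ) * (448 * y ^ 3 + 2048 * y ^ 2 - 6400 * y + 3392)
            + (e : ℂ) ^ 2 * (6624 * y ^ 3 - 9536 * y ^ 2 - 5120 * y + 5920)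
            + (scaledTerms.deriv.shift.high 3).eval e y v‖ := by ring_nf
        _ ≤ _ := norm_add₃_le.trans (by linarith)
    calc _ = ‖(scaledTerms.deriv.eval e (y + e * v) v - (128 * y ^ 3 - 512 * y + 384))
          + (scaledTerms.deriv.eval e ξ v - scaledTerms.deriv.eval e (y + e * v) v)‖ := by
          ring_nf
      _ ≤ _ := (norm_add_le _ _).trans (add_le_add h2 h1)
  refine exists_unique_zero_of_norm_sub_le (by positivity)
    (fun ξ => Terms.hasDerivAt_eval _ _ ξ v) hderiv ?_
  calc _ ≤ e ^ 2 * (a₀ + a₁ / 97 + 97 ^ 2 * T₀)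
        + (b₁ / 97 + b₂ / 97 ^ 2 + T₁ + 51 / 97 ^ 2 * T₂) * (51 * e ^ 2) := by
        gcongr
    _ = e ^ 2 * (a₀ + a₁ / 97 + 97 ^ 2 * T₀ + 51 * (b₁ / 97 + b₂ / 97 ^ 2 + T₁
      + 51 / 97 ^ 2 * T₂)) := by ring
    _ < e ^ 2 * (51 * δ) := by gcongr
    _ ≤ ‖128 * y ^ 3 - 512 * y + 384‖ * (51 * e ^ 2) := by nlinarith

/-! ### Location of the roots of the quartic -/

/-- A real cubic at a complex point, bounded through its real and imaginary parts. -/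
theorem norm_le_of_eq_cubic {y z : ℂ} (α β γ δ A C : ℝ) {B R : ℝ}
    (hz : z = α * y ^ 3 + β * y ^ 2 + γ * y + δ) (hB : |y.im| ≤ B)
    (hre : |α * (y.re ^ 3 - 3 * y.re * y.im ^ 2) + β * (y.re ^ 2 - y.im ^ 2) + γ * y.re + δ| ≤ A)
    (him : |α * (3 * y.re ^ 2 - y.im ^ 2) + 2 * β * y.re + γ| ≤ C) (hR : A + B * C ≤ R) :
    ‖z‖ ≤ R := by
  have hy : z =
      ((α * (y.re ^ 3 - 3 * y.re * y.im ^ 2) + β * (y.re ^ 2 - y.im ^ 2) + γ * y.re + δ : ℝ) : ℂ)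
      + ((y.im * (α * (3 * y.re ^ 2 - y.im ^ 2) + 2 * β * y.re + γ) : ℝ) : ℂ) * Complex.I := by
    rw [hz]
    conv_lhs => rw [← Complex.re_add_im y]
    push_cast
    linear_combination ((y.im : ℂ) ^ 2 * (3 * α * y.re + β) + α * (y.im : ℂ) ^ 3 * Complex.I) *
      Complex.I_sq
  rw [hy]
  refine ((norm_add_le _ _).trans (add_le_add ?_ ?_)).trans hR
  · rw [Complex.norm_real]; exact hre
  · rw [norm_mul, Complex.norm_I, mul_one, Complex.norm_real, Real.norm_eq_abs, abs_mul]
    exact mul_le_mul hB him (abs_nonneg _) ((abs_nonneg _).trans hB)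

theorem norm_le_of_eq_cubic_of_im_eq_zero {y z : ℂ} (α β γ δ : ℝ) {R : ℝ}
    (hz : z = α * y ^ 3 + β * y ^ 2 + γ * y + δ) (hb : y.im = 0)
    (hre : |α * y.re ^ 3 + β * y.re ^ 2 + γ * y.re + δ| ≤ R) : ‖z‖ ≤ R :=
  norm_le_of_eq_cubic α β γ δ R _ hz (abs_eq_zero.2 hb).le (by simpa [hb] using hre) le_rfl
    (by simp)

theorem real_root_location {a : ℝ} (h : a ^ 4 - 8 * a ^ 2 + 12 * a - 4 = 0) :
    (0.486 ≤ a ∧ a ≤ 0.487) ∨ (-3.4392 ≤ a ∧ a ≤ -3.4391) := by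
  rcases le_total a (-1) with ha | ha
  · right
    constructor
    · by_contra! hlt
      obtain ⟨t, ht, rfl⟩ : ∃ t > 0, a = -3.4392 - t := ⟨-3.4392 - a, by linarith, by ring⟩
      have : 0 < t ^ 2 := by positivity
      have : 0 < t ^ 3 := by positivity
      have : 0 < t ^ 4 := by positivity
      nlinarith
    · by_contra! hlt
      nlinarith [mul_nonneg (sub_nonneg.2 hlt.le) (sub_nonneg.2 ha), sq_nonneg (a + 1),
        mul_nonneg (mul_nonneg (sub_nonneg.2 hlt.le) (sub_nonneg.2 ha)) (sq_nonneg a),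
        mul_nonneg (mul_nonneg (sub_nonneg.2 hlt.le) (sub_nonneg.2 ha)) (sq_nonneg (a - 1)),
        sq_nonneg (a - 1)]
  · left
    constructor
    · by_contra! hlt
      nlinarith [mul_nonneg (sub_nonneg.2 hlt.le) (sub_nonneg.2 ha), sq_nonneg (a + 1),
        mul_nonneg (mul_nonneg (sub_nonneg.2 hlt.le) (sub_nonneg.2 ha)) (sq_nonneg a),
        mul_nonneg (mul_nonneg (sub_nonneg.2 hlt.le) (sub_nonneg.2 ha)) (sq_nonneg (a - 1)),
        sq_nonneg (a - 1)]
    · by_contra! hlt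
      obtain ⟨t, ht, rfl⟩ : ∃ t > 0, a = 0.487 + t := ⟨a - 0.487, by linarith, by ring⟩
      have h1 : 0 < t ^ 3 + 1.948 * t ^ 2 - 6.577 * t + 4.67 := by
        nlinarith [mul_nonneg ht.le (sq_nonneg (t - 1)), sq_nonneg (t - 1)]
      nlinarith [mul_pos ht h1, sq_nonneg t]

/-- Every root of the quartic is one of the two real roots or a member of the complex pair, whose
real part `a` satisfies the resolvent equation `4 a ^ 6 - 16 a ^ 4 + 20 a ^ 2 - 9 = 0`. -/
theorem root_location {y : ℂ} (h : y ^ 4 - 8 * y ^ 2 + 12 * y - 4 = 0) :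
    (y.im = 0 ∧ 0.486 ≤ y.re ∧ y.re ≤ 0.487) ∨ (y.im = 0 ∧ -3.4392 ≤ y.re ∧ y.re ≤ -3.4391) ∨
      (1.476 ≤ y.re ∧ y.re ≤ 1.477 ∧ 0.21 ≤ y.im ^ 2 ∧ y.im ^ 2 ≤ 0.214) := by
  obtain ⟨a, b⟩ := y
  have hsplit : ((⟨a, b⟩ : ℂ) ^ 4 - 8 * (⟨a, b⟩ : ℂ) ^ 2 + 12 * ⟨a, b⟩ - 4) =
      ⟨a ^ 4 - 6 * a ^ 2 * b ^ 2 + b ^ 4 - 8 * (a ^ 2 - b ^ 2) + 12 * a - 4,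
        b * (4 * a ^ 3 - 4 * a * b ^ 2 - 16 * a + 12)⟩ := by
    have h4 : (4 : ℂ) = ⟨4, 0⟩ := rfl
    have h8 : (8 : ℂ) = ⟨8, 0⟩ := rfl
    have h12 : (12 : ℂ) = ⟨12, 0⟩ := rfl
    rw [h8, h12, h4]
    apply Complex.ext <;> simp [pow_succ] <;> ring
  rw [hsplit] at h
  have hre : a ^ 4 - 6 * a ^ 2 * b ^ 2 + b ^ 4 - 8 * (a ^ 2 - b ^ 2) + 12 * a - 4 = 0 :=
    congrArg Complex.re h
  have him : b * (4 * a ^ 3 - 4 * a * b ^ 2 - 16 * a + 12) = 0 := congrArg Complex.im h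
  dsimp only
  rcases mul_eq_zero.1 him with hb | hb
  · subst hb
    rcases real_root_location (a := a) (by linarith) with h1 | h1
    · exact Or.inl ⟨rfl, h1⟩
    · exact Or.inr (Or.inl ⟨rfl, h1⟩)
  · right; right
    have hab : a * b ^ 2 = a ^ 3 - 4 * a + 3 := by linarith
    have hres : 4 * a ^ 6 - 16 * a ^ 4 + 20 * a ^ 2 - 9 = 0 := by
      have hab2 : a ^ 2 * b ^ 4 = (a ^ 3 - 4 * a + 3) ^ 2 := by rw [← hab]; ring
      linear_combination (-1 : ℝ) * a ^ 2 * hre - (6 * a ^ 3 - 8 * a) * hab + hab2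
    have hpos : 0 < a := by
      by_contra! hle
      have h0 : a < 0 := lt_of_le_of_ne hle (by rintro rfl; norm_num at hres)
      have h1 : -2 ≤ a := by
        by_contra! h2
        obtain ⟨t, ht, rfl⟩ : ∃ t > 0, a = -2 - t := ⟨-2 - a, by linarith, by ring⟩
        have : 0 < t ^ 2 := by positivity
        have : 0 < t ^ 3 := by positivity
        have : 0 < t ^ 4 := by positivity
        have : 0 < t ^ 5 := by positivity
        have : 0 < t ^ 6 := by positivity
        nlinarith
      nlinarith [mul_nonneg (neg_nonneg.2 hle) (sq_nonneg b),
        mul_nonneg (neg_nonneg.2 hle) (by nlinarith : 0 ≤ 4 - a ^ 2)]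
    have h1 : 1.476 ≤ a := by
      by_contra! hlt
      have hs : a ^ 2 ≤ 1.476 ^ 2 := by gcongr
      nlinarith [sq_nonneg (a ^ 2 - 1), sq_nonneg (a ^ 2 - 5 / 3), sq_nonneg a,
        mul_nonneg (sub_nonneg.2 hs) (sq_nonneg (a ^ 2 - 1))]
    have h2 : a ≤ 1.477 := by
      by_contra! hlt
      obtain ⟨t, ht, rfl⟩ : ∃ t > 0, a = 1.477 + t := ⟨a - 1.477, by linarith, by ring⟩
      have : 0 < t ^ 2 := by positivity
      have : 0 < t ^ 3 := by positivity
      have : 0 < t ^ 4 := by positivity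
      have : 0 < t ^ 5 := by positivity
      have : 0 < t ^ 6 := by positivity
      nlinarith
    have hp : 0 ≤ (a - 1.476) * (1.477 - a) := mul_nonneg (by linarith) (by linarith)
    have hp3 : 0 ≤ (a - 1.476) * (1.477 - a) * a := mul_nonneg hp hpos.le
    refine ⟨h1, h2, ?_, ?_⟩
    · by_contra! hlt
      have := mul_lt_mul_of_pos_left hlt hpos
      nlinarith
    · by_contra! hlt
      have := mul_lt_mul_of_pos_left hlt hpos
      nlinarith

/-- Roots `u` of the complex quartic correspond to roots `y = -i u` of the real one. -/
theorem quartic_of_mem_quarticRoots {u : ℂ} (hu : u ∈ quarticRoots) :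
    (-Complex.I * u) ^ 4 - 8 * (-Complex.I * u) ^ 2 + 12 * (-Complex.I * u) - 4 = 0 := by
  have h : u ^ 4 + 8 * u ^ 2 - 12 * Complex.I * u - 4 = 0 := hu
  linear_combination h + ((Complex.I ^ 2 - 1) * u ^ 4 - 8 * u ^ 2) * Complex.I_sq

theorem ncard_quarticRoots : quarticRoots.ncard = 4 := by
  set P : ℂ[X] := X ^ 4 + C 8 * X ^ 2 - C (12 * Complex.I) * X - C 4 with hP
  have hdeg : P.natDegree = 4 := by rw [hP]; compute_degree!
  have hP0 : P ≠ 0 := by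
    intro h
    simp [h] at hdeg
  have hroots : P.rootSet ℂ = quarticRoots := by
    ext u
    rw [mem_rootSet_of_ne hP0]
    simp [hP, quarticRoots]
  have hsep : P.Separable := by
    rw [Polynomial.Separable, isCoprime_iff_aeval_ne_zero_of_isAlgClosed ℂ ℂ]
    intro u
    by_contra! h
    have h1 : u ^ 4 + 8 * u ^ 2 - 12 * Complex.I * u - 4 = 0 := by simpa [hP] using h.1
    have h2 : 4 * u ^ 3 + 16 * u - 12 * Complex.I = 0 := by
      have := h.2
      simp [hP] at this
      linear_combination this
    have h3 : -Complex.I * u = -12 := by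
      have hy := quartic_of_mem_quarticRoots h1
      set y := -Complex.I * u with hydef
      have hu : u = Complex.I * y := by
        rw [hydef]; linear_combination u * Complex.I_sq
      have hy3 : y ^ 3 = 4 * y - 3 := by
        rw [hu] at h2
        linear_combination Complex.I / 4 * h2
          + (-Complex.I ^ 2 * y ^ 3 + y ^ 3 - 4 * y + 3) * Complex.I_sq
      have hy2 : 4 * y ^ 2 = 9 * y - 4 := by linear_combination y * hy3 - hy
      linear_combination 16 * hy3 - (4 * y + 9) * hy2
    have h4 := quartic_of_mem_quarticRoots h1
    rw [h3] at h4
    norm_num at h4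
  rw [← hroots, ← Nat.card_coe_set_eq, Nat.card_eq_fintype_card,
    card_rootSet_eq_natDegree hsep (IsAlgClosed.splits _), hdeg]

/-! ### Numerical verification at each root -/

theorem re_quartic_deriv (y : ℂ) : (128 * y ^ 3 - 512 * y + 384).re =
    128 * (y.re ^ 3 - 3 * y.re * y.im ^ 2) - 512 * y.re + 384 := by
  simp [pow_succ]; ring

theorem im_quartic_deriv (y : ℂ) : (128 * y ^ 3 - 512 * y + 384).im =
    y.im * (128 * (3 * y.re ^ 2 - y.im ^ 2) - 512) := by
  simp [pow_succ]; ring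

theorem exists_unique_zero_of_root_pos {y : ℂ}
    (hy : y ^ 4 - 8 * y ^ 2 + 12 * y - 4 = 0) (hb : y.im = 0) (hl : 0.486 ≤ y.re) (hu : y.re ≤ 0.487)
    {e : ℝ} (he0 : e ≠ 0) (he : |e| ≤ 1 / 97) {v : ℂ} (hv : v = (y ^ 2 - y) / 2) :
    ∃ t ∈ Metric.ball (y + e * v) (51 * e ^ 2), scaledTerms.eval e t v = 0 ∧
      scaledTerms.deriv.eval e t v ≠ 0 ∧
      ∀ s ∈ Metric.ball (y + e * v) (51 * e ^ 2), scaledTerms.eval e s v = 0 → s = t := by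
  -- these make `y.re ^ 2` and `y.re ^ 3` accurate to second order in the width of the interval
  have h1 : 0 ≤ (y.re - 0.486) * (0.487 - y.re) := mul_nonneg (by linarith) (by linarith)
  have h2 : 0 ≤ (y.re - 0.486) * (0.487 - y.re) * y.re := mul_nonneg h1 (by linarith)
  have h3 : 0 ≤ (y.re - 0.486) ^ 2 := sq_nonneg _
  have h4 : 0 ≤ (y.re - 0.486) ^ 2 * y.re := mul_nonneg h3 (by linarith)
  refine exists_unique_zero_scaledTerms hy hv (M := 487 / 1000) (V := 126 / 1000) (a₀ := 20)
    (a₁ := 500) (b₁ := 900) (b₂ := 2500) (δ := 149)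
    ?_ ?_ ?_ ?_ ?_ ?_ ?_ ?_ he0 he
  · refine norm_le_of_eq_cubic_of_im_eq_zero 0 0 1 0 (by push_cast; ring) hb ?_
    push_cast
    exact abs_le.2 ⟨by linarith, by linarith⟩
  · refine norm_le_of_eq_cubic_of_im_eq_zero 0 (1 / 2) (-1 / 2) 0 (by rw [hv]; push_cast; ring) hb ?_
    push_cast
    exact abs_le.2 ⟨by linarith, by linarith⟩
  · refine norm_le_of_eq_cubic_of_im_eq_zero (-1088) 3776 (-4224) 1280 (by push_cast; ring) hb ?_
    push_cast
    exact abs_le.2 ⟨by linarith, by linarith⟩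
  · refine norm_le_of_eq_cubic_of_im_eq_zero 18176 (-62160) 68896 (-20928) (by push_cast; ring) hb ?_
    push_cast
    exact abs_le.2 ⟨by linarith, by linarith⟩
  · refine norm_le_of_eq_cubic_of_im_eq_zero 448 2048 (-6400) 3392 (by push_cast; ring) hb ?_
    push_cast
    exact abs_le.2 ⟨by linarith, by linarith⟩
  · refine norm_le_of_eq_cubic_of_im_eq_zero 6624 (-9536) (-5120) 5920 (by push_cast; ring) hb ?_
    push_cast
    exact abs_le.2 ⟨by linarith, by linarith⟩
  · refine le_trans ?_ ((le_abs_self _).trans (Complex.abs_re_le_norm _))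
    rw [re_quartic_deriv, hb]
    push_cast
    linarith
  · decide +kernel

/-- The tightest case: here the coefficient of the third order of the zero is about `34`, against
the admissible `51`, so `a₀`, `a₁` and the enclosure of `y.re` have little room. -/
theorem exists_unique_zero_of_root_neg {y : ℂ}
    (hy : y ^ 4 - 8 * y ^ 2 + 12 * y - 4 = 0) (hb : y.im = 0) (hl : -3.4392 ≤ y.re) (hu : y.re ≤ -3.4391)
    {e : ℝ} (he0 : e ≠ 0) (he : |e| ≤ 1 / 97) {v : ℂ} (hv : v = (y ^ 2 - y) / 2) :
    ∃ t ∈ Metric.ball (y + e * v) (51 * e ^ 2), scaledTerms.eval e t v = 0 ∧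
      scaledTerms.deriv.eval e t v ≠ 0 ∧
      ∀ s ∈ Metric.ball (y + e * v) (51 * e ^ 2), scaledTerms.eval e s v = 0 → s = t := by
  -- these make `y.re ^ 2` and `y.re ^ 3` accurate to second order in the width of the interval
  have h1 : 0 ≤ (y.re + 3.4392) * (-3.4391 - y.re) := mul_nonneg (by linarith) (by linarith)
  have h2 : 0 ≤ (y.re + 3.4392) * (-3.4391 - y.re) * (-y.re) := mul_nonneg h1 (by linarith)
  have h3 : 0 ≤ (y.re + 3.4392) ^ 2 := sq_nonneg _
  have h4 : 0 ≤ (y.re + 3.4392) ^ 2 * (-y.re) := mul_nonneg h3 (by linarith)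
  refine exists_unique_zero_scaledTerms hy hv (M := 34392 / 10000) (V := 7634 / 1000)
    (a₀ := 104800) (a₁ := 1735000) (b₁ := 31600) (b₂ := 365000) (δ := 3061)
    ?_ ?_ ?_ ?_ ?_ ?_ ?_ ?_ he0 he
  · refine norm_le_of_eq_cubic_of_im_eq_zero 0 0 1 0 (by push_cast; ring) hb ?_
    push_cast
    exact abs_le.2 ⟨by linarith, by linarith⟩
  · refine norm_le_of_eq_cubic_of_im_eq_zero 0 (1 / 2) (-1 / 2) 0 (by rw [hv]; push_cast; ring) hb ?_
    push_cast
    exact abs_le.2 ⟨by linarith, by linarith⟩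
  · refine norm_le_of_eq_cubic_of_im_eq_zero (-1088) 3776 (-4224) 1280 (by push_cast; ring) hb ?_
    push_cast
    exact abs_le.2 ⟨by linarith, by linarith⟩
  · refine norm_le_of_eq_cubic_of_im_eq_zero 18176 (-62160) 68896 (-20928) (by push_cast; ring) hb ?_
    push_cast
    exact abs_le.2 ⟨by linarith, by linarith⟩
  · refine norm_le_of_eq_cubic_of_im_eq_zero 448 2048 (-6400) 3392 (by push_cast; ring) hb ?_
    push_cast
    exact abs_le.2 ⟨by linarith, by linarith⟩
  · refine norm_le_of_eq_cubic_of_im_eq_zero 6624 (-9536) (-5120) 5920 (by push_cast; ring) hb ?_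
    push_cast
    exact abs_le.2 ⟨by linarith, by linarith⟩
  · refine le_trans ?_ ((neg_le_abs _).trans (Complex.abs_re_le_norm _))
    rw [re_quartic_deriv, hb]
    push_cast
    linarith
  · decide +kernel

theorem exists_unique_zero_of_root_nonreal {y : ℂ}
    (hy : y ^ 4 - 8 * y ^ 2 + 12 * y - 4 = 0) (hl : 1.476 ≤ y.re) (hu : y.re ≤ 1.477)
    (hl' : 0.21 ≤ y.im ^ 2) (hu' : y.im ^ 2 ≤ 0.214)
    {e : ℝ} (he0 : e ≠ 0) (he : |e| ≤ 1 / 97) {v : ℂ} (hv : v = (y ^ 2 - y) / 2) :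
    ∃ t ∈ Metric.ball (y + e * v) (51 * e ^ 2), scaledTerms.eval e t v = 0 ∧
      scaledTerms.deriv.eval e t v ≠ 0 ∧
      ∀ s ∈ Metric.ball (y + e * v) (51 * e ^ 2), scaledTerms.eval e s v = 0 → s = t := by
  have hB : |y.im| ≤ 0.463 := by
    rw [← Real.sqrt_sq_eq_abs]
    exact Real.sqrt_le_iff.2 ⟨by norm_num, by linarith⟩
  have hB' : 0.458 ≤ |y.im| := by
    rw [← Real.sqrt_sq_eq_abs]
    exact Real.le_sqrt_of_sq_le (by linarith)
  have h1 : 0 ≤ (y.re - 1.476) * (1.477 - y.re) := mul_nonneg (by linarith) (by linarith)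
  have h2 : 0 ≤ (y.re - 1.476) * (1.477 - y.re) * y.re := mul_nonneg h1 (by linarith)
  have h3 : 0 ≤ (y.re - 1.476) ^ 2 := sq_nonneg _
  have h4 : 0 ≤ (y.re - 1.476) ^ 2 * y.re := mul_nonneg h3 (by linarith)
  have h5 : 0 ≤ y.re * (y.im ^ 2 - 0.21) := mul_nonneg (by linarith) (by linarith)
  have h6 : 0 ≤ y.re * (0.214 - y.im ^ 2) := mul_nonneg (by linarith) (by linarith)
  refine exists_unique_zero_scaledTerms hy hv (M := 194 / 100) (V := 8 / 10) (a₀ := 300)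
    (a₁ := 6000) (b₁ := 3000) (b₂ := 20000) (δ := 130) ?_ ?_ ?_ ?_ ?_ ?_ ?_ ?_ he0 he
  · exact norm_le_of_eq_cubic 0 0 1 0 1.477 1 (by push_cast; ring) hB
      (abs_le.2 ⟨by linarith, by linarith⟩) (abs_le.2 ⟨by linarith, by linarith⟩) (by norm_num)
  · exact norm_le_of_eq_cubic 0 (1 / 2) (-1 / 2) 0 0.3 1 (by rw [hv]; push_cast; ring) hB
      (abs_le.2 ⟨by linarith, by linarith⟩) (abs_le.2 ⟨by linarith, by linarith⟩) (by norm_num)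
  · exact norm_le_of_eq_cubic (-1088) 3776 (-4224) 1280 100 200 (by push_cast; ring) hB
      (abs_le.2 ⟨by linarith, by linarith⟩) (abs_le.2 ⟨by linarith, by linarith⟩) (by norm_num)
  · exact norm_le_of_eq_cubic 18176 (-62160) 68896 (-20928) 3000 3000 (by push_cast; ring) hB
      (abs_le.2 ⟨by linarith, by linarith⟩) (abs_le.2 ⟨by linarith, by linarith⟩) (by norm_num)
  · exact norm_le_of_eq_cubic 448 2048 (-6400) 3392 1100 2700 (by push_cast; ring) hB
      (abs_le.2 ⟨by linarith, by linarith⟩) (abs_le.2 ⟨by linarith, by linarith⟩) (by norm_num)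
  · exact norm_le_of_eq_cubic 6624 (-9536) (-5120) 5920 10000 20000 (by push_cast; ring) hB
      (abs_le.2 ⟨by linarith, by linarith⟩) (abs_le.2 ⟨by linarith, by linarith⟩) (by norm_num)
  · refine le_trans ?_ (Complex.abs_im_le_norm _)
    rw [im_quartic_deriv, abs_mul]
    have h7 : (290 : ℝ) ≤ |128 * (3 * y.re ^ 2 - y.im ^ 2) - 512| :=
      le_trans (by linarith) (le_abs_self _)
    calc ((130 : ℚ) : ℝ) ≤ 0.458 * 290 := by norm_num
      _ ≤ _ := mul_le_mul hB' h7 (by norm_num) (abs_nonneg _)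
  · decide +kernel

theorem exists_unique_zero_of_root {y : ℂ} (hy : y ^ 4 - 8 * y ^ 2 + 12 * y - 4 = 0)
    {e : ℝ} (he0 : e ≠ 0) (he : |e| ≤ 1 / 97) {v : ℂ} (hv : v = (y ^ 2 - y) / 2) :
    ∃ t ∈ Metric.ball (y + e * v) (51 * e ^ 2), scaledTerms.eval e t v = 0 ∧
      scaledTerms.deriv.eval e t v ≠ 0 ∧
      ∀ s ∈ Metric.ball (y + e * v) (51 * e ^ 2), scaledTerms.eval e s v = 0 → s = t := by
  rcases root_location hy with ⟨hb, hl, hu⟩ | ⟨hb, hl, hu⟩ | ⟨hl, hu, hl', hu'⟩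
  · exact exists_unique_zero_of_root_pos hy hb hl hu he0 he hv
  · exact exists_unique_zero_of_root_neg hy hb hl hu he0 he hv
  · exact exists_unique_zero_of_root_nonreal hy hl hu hl' hu' he0 he hv

/-! ### The disks in the variable `t` -/

theorem cuboidPoly_zero_left (q : ℂ) :
    cuboidPoly 0 q =
      (X + C (Complex.I * q ^ 2)) ^ 4 * (X - C (q ^ 2)) * (X + C (q ^ 2))
        * (X - C (Complex.I * q ^ 2)) ^ 4 := by
  have hI : (C (Complex.I * q ^ 2) : ℂ[X]) ^ 2 = -C (q ^ 2) ^ 2 := by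
    rw [← C_pow, mul_pow, Complex.I_sq, ← C_pow, ← C_neg]; ring_nf
  have h8 : (X + C (Complex.I * q ^ 2)) ^ 4 * (X - C (Complex.I * q ^ 2)) ^ 4 =
      (X ^ 2 + C (q ^ 2) ^ 2 : ℂ[X]) ^ 4 := by
    rw [← mul_pow]
    congr 1
    linear_combination -hI
  calc cuboidPoly 0 q = (X ^ 2 + C (q ^ 2) ^ 2) ^ 4 * (X ^ 2 - C (q ^ 2) ^ 2) := by
        have h2 : (C 2 : ℂ[X]) = 2 := C_ofNat 2
        have h3 : (C 3 : ℂ[X]) = 3 := C_ofNat 3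
        simp [cuboidPoly, h2, h3]
        ring
    _ = _ := by rw [← h8]; ring

theorem cuboidPoly_ne_zero (p q : ℂ) : cuboidPoly p q ≠ 0 := by
  have h : (cuboidPoly p q).natDegree = 10 := by
    unfold cuboidPoly
    compute_degree!
  intro h0
  simp [h0] at h

/-- For `e = p / q ≠ 0` the affine map `ξ ↦ i q² (1 + e ξ)` carries the disk of radius `51 e²`
about `y + e (y² - y) / 2` onto the disk attached to `u = i y`, and simple zeros to simple
roots. -/
theorem exists_simple_root {p q : ℝ} (hpq : 97 * |p| ≤ q) (hp : p ≠ 0) {u : ℂ}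
    (hu : u ∈ quarticRoots) :
    ∃ t ∈ Metric.ball (diskCenter u p q) (diskRadius p q),
      (cuboidPoly p q).rootMultiplicity t = 1 ∧
      ∀ s ∈ Metric.ball (diskCenter u p q) (diskRadius p q),
        (cuboidPoly p q).IsRoot s → s = t := by
  have hq : 0 < q := lt_of_lt_of_le (by positivity) hpq
  have hqC : (q : ℂ) ≠ 0 := by exact_mod_cast hq.ne'
  set e : ℝ := p / q with he
  have he0 : e ≠ 0 := div_ne_zero hp hq.ne'
  have heC : (e : ℂ) ≠ 0 := by exact_mod_cast he0
  have hp_eq : (p : ℂ) = e * q := by rw [he]; push_cast; field_simp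
  have habs : |e| ≤ 1 / 97 := by
    rw [he, abs_div, abs_of_pos hq, div_le_iff₀ hq]; linarith
  set y : ℂ := -Complex.I * u with hy
  set v : ℂ := (y ^ 2 - y) / 2 with hv
  have huy : u = Complex.I * y := by rw [hy]; linear_combination u * Complex.I_sq
  obtain ⟨ξ, hξ, hξ0, hξ1, hξu⟩ :=
    exists_unique_zero_of_root (quartic_of_mem_quarticRoots hu) he0 habs hv
  set φ : ℂ → ℂ := fun ζ => Complex.I * q ^ 2 * (1 + e * ζ) with hφ
  have hcenter : diskCenter u p q = φ (y + e * v) := by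
    simp only [diskCenter, hφ, hp_eq, huy, hv]
    linear_combination (-(Complex.I * y ^ 2 * e ^ 2 * q ^ 2 / 2)) * Complex.I_sq
  have hradius : diskRadius p q = q ^ 2 * |e| * (51 * e ^ 2) := by
    rw [diskRadius, ← sq_abs e, he, abs_div, abs_of_pos hq]; field_simp
  have hball : ∀ ζ, φ ζ ∈ Metric.ball (diskCenter u p q) (diskRadius p q) ↔
      ζ ∈ Metric.ball (y + e * v) (51 * e ^ 2) := by
    intro ζ
    have : φ ζ - φ (y + e * v) = Complex.I * q ^ 2 * e * (ζ - (y + e * v)) := by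
      simp only [hφ]; ring
    rw [mem_ball_iff_norm, mem_ball_iff_norm, hcenter, hradius, this]
    have hn : ‖Complex.I * q ^ 2 * e * (ζ - (y + e * v))‖ = q ^ 2 * |e| * ‖ζ - (y + e * v)‖ := by
      simp
    rw [hn]
    exact mul_lt_mul_iff_right₀ (by positivity)
  have hroot : ∀ ζ, (cuboidPoly p q).IsRoot (φ ζ) ↔ scaledTerms.eval e ζ v = 0 := by
    intro ζ
    rw [IsRoot.def, hp_eq, hφ, eval_cuboidPoly q e ζ v]
    simp [hqC, heC]
  refine ⟨φ ξ, (hball ξ).2 hξ, ?_, ?_⟩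
  · have hpos : 0 < (cuboidPoly p q).rootMultiplicity (φ ξ) :=
      (rootMultiplicity_pos (cuboidPoly_ne_zero _ _)).2 ((hroot ξ).2 hξ0)
    have hle : ¬ 1 < (cuboidPoly p q).rootMultiplicity (φ ξ) := by
      rw [one_lt_rootMultiplicity_iff_isRoot (cuboidPoly_ne_zero _ _)]
      rintro ⟨-, hd⟩
      -- compare the two expressions for the derivative of `ζ ↦ Q (φ ζ)` at `ξ`
      have h1 : HasDerivAt (fun ζ => (cuboidPoly p q).eval (φ ζ))
          ((derivative (cuboidPoly p q)).eval (φ ξ) * (Complex.I * q ^ 2 * (e * 1))) ξ :=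
        ((cuboidPoly p q).hasDerivAt (φ ξ)).comp ξ
          ((((hasDerivAt_id ξ).const_mul (e : ℂ)).const_add 1).const_mul (Complex.I * q ^ 2))
      have h2 : HasDerivAt (fun ζ => (cuboidPoly p q).eval (φ ζ))
          (-(q ^ 20 * e ^ 4) * scaledTerms.deriv.eval e ξ v : ℂ) ξ := by
        have : (fun ζ => (cuboidPoly p q).eval (φ ζ)) =
            fun ζ => (-(q ^ 20 * e ^ 4) * scaledTerms.eval e ζ v : ℂ) := by
          funext ζ
          rw [hp_eq, hφ, eval_cuboidPoly q e ζ v]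
        rw [this]
        exact (Terms.hasDerivAt_eval scaledTerms e ξ v).const_mul _
      have h3 := h1.unique h2
      rw [hd.eq_zero, zero_mul] at h3
      have h4 : (-(q ^ 20 * e ^ 4) * scaledTerms.deriv.eval e ξ v : ℂ) ≠ 0 :=
        mul_ne_zero (neg_ne_zero.2 (by positivity)) hξ1
      exact h4 h3.symm
    omega
  · intro s hs hsr
    obtain ⟨ζ, rfl⟩ : ∃ ζ, φ ζ = s :=
      ⟨(s / (Complex.I * q ^ 2) - 1) / e, by
        simp only [hφ]; field_simp; ring⟩
    rw [hξu ζ ((hball ζ).1 hs) ((hroot ζ).1 hsr)]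

theorem theorem5p1 :
    quarticRoots.ncard = 4 ∧
    ∀ p q : ℝ, 97 * |p| ≤ q →
      (p ≠ 0 → ∀ u ∈ quarticRoots,
        ∃ t ∈ Metric.ball (diskCenter u p q) (diskRadius p q),
          (cuboidPoly p q).rootMultiplicity t = 1 ∧
          ∀ s ∈ Metric.ball (diskCenter u p q) (diskRadius p q),
            (cuboidPoly p q).IsRoot s → s = t) ∧
      (p = 0 →
        (∀ u ∈ quarticRoots,
          Metric.closedBall (diskCenter u p q) (diskRadius p q) = {Complex.I * (q : ℂ) ^ 2}) ∧
        1 < (cuboidPoly p q).rootMultiplicity (Complex.I * (q : ℂ) ^ 2) ∧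
        (0 < q → (cuboidPoly p q).rootMultiplicity (Complex.I * (q : ℂ) ^ 2) = 4)) := by
  refine ⟨ncard_quarticRoots, fun p q hpq => ⟨fun hp u hu => exists_simple_root hpq hp hu, ?_⟩⟩
  rintro rfl
  set A : ℂ[X] := (X + C (Complex.I * (q : ℂ) ^ 2)) ^ 4 * (X - C ((q : ℂ) ^ 2))
    * (X + C ((q : ℂ) ^ 2)) with hA
  have hfac : cuboidPoly ((0 : ℝ) : ℂ) q = A * (X - C (Complex.I * (q : ℂ) ^ 2)) ^ 4 := by
    rw [Complex.ofReal_zero, cuboidPoly_zero_left]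
  have hA0 : A ≠ 0 := by
    intro h
    rw [h, zero_mul] at hfac
    exact cuboidPoly_ne_zero _ _ hfac
  refine ⟨fun u _ => by simp [diskCenter, diskRadius], ?_, fun hq => ?_⟩
  · rw [hfac, rootMultiplicity_mul_X_sub_C_pow hA0]
    omega
  · have hqC : (q : ℂ) ≠ 0 := by exact_mod_cast hq.ne'
    have hI1 : Complex.I - 1 ≠ 0 := fun h => by simpa using congrArg Complex.re h
    have hI2 : Complex.I + 1 ≠ 0 := fun h => by simpa using congrArg Complex.re h
    have hnot : ¬ A.IsRoot (Complex.I * (q : ℂ) ^ 2) := by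
      have : A.eval (Complex.I * (q : ℂ) ^ 2) = (2 * Complex.I * q ^ 2) ^ 4
          * ((Complex.I - 1) * q ^ 2) * ((Complex.I + 1) * q ^ 2) := by
        simp only [hA, eval_mul, eval_pow, eval_add, eval_sub, eval_X, eval_C]
        ring
      rw [IsRoot.def, this]
      simp [hqC, hI1, hI2]
    rw [hfac, rootMultiplicity_mul_X_sub_C_pow hA0, rootMultiplicity_eq_zero hnot]
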